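/- Let $E$ be a real or complex vector space with a countably infinite Hamel basis $(e_n)_{n=1}^\infty$. An (infinite or finite) sequence $(v_k)$ of nonzero vectors is a block basis if there are integers $0=p_0<p_1<p_2<\cdots$ with $v_k\in\operatorname{span}\{e_j: p_{k-1}<j\le p_k\}$ for all $k$; the empty sequence is the block basis of length $0$. Let $\Sigma_\infty(E)\subset E^{\mathbb N}$ be the set of infinite block bases, and $\Sigma_{<\infty}(E)$ the set of finite ones. Let $\mathcal B(E)$ be the set of infinite-dimensional block subspaces, i.e. linear spans of infinite block bases. Give $E$ its intrinsic topology $\mathcal T$ (a set is open iff its intersection with every finite-dimensional subspace $F$ is open in $F$), and $\Sigma_\infty(E)\subset E^{\mathbb N}$ the topology $\mathcal T_p$ induced by the product topology. A set $\sigma\subset\Sigma_\infty(E)$ is large if for every $V\in\mathcal B(E)$ it contains a block basis all of whose terms lie in $V$. A strategy is a map $\Phi:\Sigma_{<\infty}(E)\times\mathcal B(E)\to\Sigma_{<\infty}(E)$ such that $\Phi(u_1,\dots,u_n;V)=(u_1,\dots,u_n,u_{n+1})$ with $u_{n+1}\in V$. A set $\tau\subset\Sigma_\infty(E)$ is strategically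 large for $V\in\mathcal B(E)$ if there is a strategy $\Phi$ such that, for every sequence $(V_j)_{j=1}^\infty$ in $\mathcal B(E)$ with $V_j\subset V$, the infinite block basis $(u_1,u_2,\dots)$ defined by $(u_1,\dots,u_{j})=\Phi(u_1,\dots,u_{j-1};V_j)$ for $j\ge1$ (starting from the empty block basis) belongs to $\tau$. An $F$-norm on $E$ is a function $\rho:E\to[0,\infty)$ with $\rho(x)=0$ iff $x=0$, $\rho(x+y)\le\rho(x)+\rho(y)$, $\rho(ax)\le\rho(x)$ for all scalars $|a|\le1$, and $\lim_{a\to0}\rho(ax)=0$ for every $x$. **Theorem.** Let $\sigma$ be a large subset of $\Sigma_\infty(E)$. Suppose: (a) there is a sequence of absolutely convex sets $C_n\subset E$ such that $C_n\cap F$ is compact for every $n$ and every finite-dimensional subspace $F$ of $E$, and $\sigma\subset\prod_{n=1}^\infty C_n$; (b) $\sigma$ is analytic as a subset of $(\Sigma_\infty(E),\mathcal T_p)$, i.e. it is empty or a continuous image of $\mathbb N^{\mathbb N}$. Let $(\rho_n)$ be any sequence of $F$-norms on $E$, and for $u=(u_j),v=(v_j)\in\Sigma_\infty(E)$ put $$d(u,v)=\sum_{j=1}^\infty\rho_j(u_j-v_j)\in[0,\infty].$$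 For $\varepsilon>0$ let $\sigma_\varepsilon=\{u\in\Sigma_\infty(E):\ \inf_{v\in\sigma}d(u,v)<\varepsilon\}$. Then for every $\varepsilon>0$ there is $V\in\mathcal B(E)$ such that $\sigma_\varepsilon$ is strategically large for $V$. -/

import Mathlib

open scoped ENNReal ComplexOrder

/-- The intrinsic topology of a vector space: a set is open iff its trace on every
finite-dimensional subspace `F` is open for the canonical topology of `F`
(the module topology of `F`, which is its usual Euclidean topology). -/
@[reducible] def intrinsicTopology (𝕜 E : Type*) [RCLike 𝕜] [AddCommGroup E] [Module 𝕜 E] :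
    TopologicalSpace E where
  IsOpen U := ∀ F : Submodule 𝕜 E, FiniteDimensional 𝕜 F →
    @IsOpen F (moduleTopology 𝕜 F) {x : F | (x : E) ∈ U}
  isOpen_univ := fun F _ => @isOpen_univ F (moduleTopology 𝕜 F)
  isOpen_inter := fun _ _ hs ht F hF =>
    @IsOpen.inter F (moduleTopology 𝕜 F) _ _ (hs F hF) (ht F hF)
  isOpen_sUnion := fun S hS F hF => by
    let _ : TopologicalSpace F := moduleTopology 𝕜 F
    have h : {x : F | (x : E) ∈ ⋃₀ S} = ⋃ s ∈ S, {x : F | (x : E) ∈ s} := by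
      ext x; simp
    rw [h]
    exact isOpen_biUnion fun s hs => hS s hs F hF

/-- The trace of `C` on every finite-dimensional subspace `F` is compact, for the canonical
topology of `F`. -/
def IsFinDimCompact (𝕜 : Type*) {E : Type*} [RCLike 𝕜] [AddCommGroup E] [Module 𝕜 E]
    (C : Set E) : Prop :=
  ∀ F : Submodule 𝕜 E, FiniteDimensional 𝕜 F →
    @IsCompact F (moduleTopology 𝕜 F) {x : F | (x : E) ∈ C}

/-- `F`-norms on a real or complex vector space. -/
structure IsFNorm (𝕜 : Type*) {E : Type*} [RCLike 𝕜] [AddCommGroup E] [Module 𝕜 E]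
    (ρ : E → ℝ) : Prop where
  map_zero : ρ 0 = 0
  pos : ∀ x : E, x ≠ 0 → 0 < ρ x
  add_le : ∀ x y : E, ρ (x + y) ≤ ρ x + ρ y
  smul_le : ∀ (a : 𝕜) (x : E), ‖a‖ ≤ 1 → ρ (a • x) ≤ ρ x
  tendsto_smul : ∀ x : E,
    Filter.Tendsto (fun a : 𝕜 => ρ (a • x)) (nhds (0 : 𝕜)) (nhds (0 : ℝ))

section BlockBases

variable {𝕜 E : Type*} [RCLike 𝕜] [AddCommGroup E] [Module 𝕜 E] (e : Module.Basis ℕ 𝕜 E)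

/-- Infinite block bases of the Hamel basis `e` (all sequences are indexed from `0`). -/
def IsBlockSeq (v : ℕ → E) : Prop :=
  ∃ p : ℕ → ℕ, p 0 = 0 ∧ StrictMono p ∧
    ∀ k, v k ≠ 0 ∧ v k ∈ Submodule.span 𝕜 (e '' Set.Ico (p k) (p (k + 1)))

/-- Finite block bases of `e`, as lists; the empty list is the block basis of length `0`. -/
def IsBlockList (l : List E) : Prop :=
  ∃ p : ℕ → ℕ, p 0 = 0 ∧ StrictMono p ∧
    ∀ (k : ℕ) (hk : k < l.length),
      l[k] ≠ 0 ∧ l[k] ∈ Submodule.span 𝕜 (e '' Set.Ico (p k) (p (k + 1)))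

/-- The set of all infinite block bases of `e`. -/
def SigmaInf : Set (ℕ → E) := {v | IsBlockSeq e v}

/-- The type of all finite block bases of `e`. -/
def SigmaFin : Type _ := {l : List E // IsBlockList e l}

theorem isBlockList_nil : IsBlockList e ([] : List E) :=
  ⟨id, rfl, strictMono_id, fun k hk => absurd hk (Nat.not_lt_zero k)⟩

/-- The empty block basis. -/
def SigmaFin.empty : SigmaFin e := ⟨[], isBlockList_nil e⟩

/-- Infinite-dimensional block subspaces: the linear spans of infinite block bases. -/
def IsBlockSubspace (V : Submodule 𝕜 E) : Prop :=
  ∃ v ∈ SigmaInf e, V = Submodule.span 𝕜 (Set.range v)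

/-- The type of all infinite-dimensional block subspaces. -/
def BlockSubspace : Type _ := {V : Submodule 𝕜 E // IsBlockSubspace e V}

/-- Every infinite-dimensional block subspace contains a member of `σ`. -/
def IsLarge (σ : Set (ℕ → E)) : Prop :=
  ∀ V : Submodule 𝕜 E, IsBlockSubspace e V → ∃ u ∈ σ, u ∈ SigmaInf e ∧ ∀ k, u k ∈ V

/-- A strategy: given a finite block basis and a block subspace `V`, it prolongs the block basis
by exactly one vector, taken from `V`. -/
structure BlockStrategy where
  next : SigmaFin e → BlockSubspace e → SigmaFin e
  next_spec : ∀ (u : SigmaFin e) (V : BlockSubspace e),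
    ∃ x ∈ V.1, (next u V).1 = u.1 ++ [x]

variable {e}

/-- The position after `m` moves, starting at `u`, when the subspaces `W 0, W 1, …` are played. -/
def BlockStrategy.position (Φ : BlockStrategy e) (u : SigmaFin e) (W : ℕ → BlockSubspace e) :
    ℕ → SigmaFin e
  | 0 => u
  | m + 1 => Φ.next (BlockStrategy.position Φ u W m) (W m)

/-- The infinite sequence produced by the strategy. Its `k`-th term is read off the position after
`k + 1` moves, which has more than `k` terms, so the default value is never used. -/
def BlockStrategy.outcome (Φ : BlockStrategy e) (u : SigmaFin e) (W : ℕ → BlockSubspace e) :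
    ℕ → E :=
  fun k => (Φ.position u W (k + 1)).1.getD k 0

variable (e)

/-- `σ` is strategically large for the block subspace `V` and the finite block basis `u`. -/
def IsStrategicallyLargeAt (σ : Set (ℕ → E)) (V : BlockSubspace e) (u : SigmaFin e) : Prop :=
  ∃ Φ : BlockStrategy e, ∀ W : ℕ → BlockSubspace e, (∀ j, (W j).1 ≤ V.1) → Φ.outcome u W ∈ σ

/-- `σ` is strategically large for the block subspace `V`. -/
def IsStrategicallyLarge (σ : Set (ℕ → E)) (V : BlockSubspace e) : Prop :=
  IsStrategicallyLargeAt e σ V (SigmaFin.empty e)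

/-- The product topology on the space of infinite block bases, where `E` carries its intrinsic
topology. -/
@[reducible] def sigmaInfTopology : TopologicalSpace (SigmaInf e) :=
  letI : TopologicalSpace E := intrinsicTopology 𝕜 E
  inferInstance

/-- `σ` is an analytic subset of the space of infinite block bases. -/
def IsAnalyticInSigmaInf (σ : Set (ℕ → E)) : Prop :=
  @MeasureTheory.AnalyticSet (SigmaInf e) (sigmaInfTopology e) {u | (u : ℕ → E) ∈ σ}

end BlockBases

section Enlargement

variable {E : Type*} [AddCommGroup E]

/-- `d(u, v) = ∑ ρ_j (u_j - v_j)`, with values in `[0, ∞]`. -/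
noncomputable def blockDist (ρ : ℕ → E → ℝ) (u v : ℕ → E) : ℝ≥0∞ :=
  ∑' j, ENNReal.ofReal (ρ j (u j - v j))

/-- The infinite block bases `u` with `inf_{v ∈ σ} d(u, v) < ε`. -/
def enlargement {𝕜 : Type*} [RCLike 𝕜] [Module 𝕜 E] (e : Module.Basis ℕ 𝕜 E)
    (ρ : ℕ → E → ℝ) (σ : Set (ℕ → E)) (ε : ℝ) : Set (ℕ → E) :=
  {u | u ∈ SigmaInf e ∧ (⨅ v ∈ σ, blockDist ρ u v) < ENNReal.ofReal ε}

end Enlargement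

/-! This is Gowers' dichotomy, run on a countable alphabet. A letter codes a box of vectors
supported in an interval of the basis; the boxes are so small that two sequences lying termwise in
the same boxes have `blockDist` below `ε`. The set `σ` is the range of a coordinatewise continuous
`f` on the Baire space, and `cellScheme` is the resulting Suslin scheme of letter sequences.

By fusion, `exists_avoids_or_reaches` stabilises the countably many statements about a finite
position and a finite string of digits. In the stabilised subspace, either the first player of the
asymptotic game avoids the scheme, or the second player of the Gowers game has, at each good pair, a
well-founded plan leading to a good pair with one more digit.

`not_avoids_cellScheme` excludes the first case. By compactness, finitely many letters per term and
interval suffice to cover `σ`, so the demands of an asymptotic strategy along such letters are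
dominated by a gap function. Largeness gives a member of `σ` in a block subspace with these gaps,
and its letters defeat the strategy.

In the second case each letter is realised by a vector of its box in the subspace just played. Ranks
cannot drop forever, so the digits form an infinite `z`. Good positions are initial segments of
members of the scheme, boxes are closed and `f` is continuous, so `f z` lies in the boxes of the
play and the outcome is close to a member of `σ`. -/

/-! ### Abstract block games and the Ramsey dichotomy for Suslin schemes. -/

section AbstractGame

universe u v

/-- The first `k` terms of a sequence, as a list. -/
def initialSegment {α : Type*} (x : ℕ → α) (k : ℕ) : List α := (List.range k).map x

theorem initialSegment_succ {α : Type*} (x : ℕ → α) (k : ℕ) :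
    initialSegment x (k + 1) = initialSegment x k ++ [x k] := by
  simp [initialSegment, List.range_succ]

@[simp] theorem initialSegment_zero {α : Type*} (x : ℕ → α) : initialSegment x 0 = [] := rfl

@[simp] theorem length_initialSegment {α : Type*} (x : ℕ → α) (k : ℕ) :
    (initialSegment x k).length = k := by
  simp [initialSegment]

theorem getElem_initialSegment {α : Type*} (x : ℕ → α) (k i : ℕ)
    (h : i < (initialSegment x k).length) : (initialSegment x k)[i] = x i := by
  simp [initialSegment]

theorem take_initialSegment {α : Type*} (x : ℕ → α) {j k : ℕ} (h : j ≤ k) :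
    (initialSegment x k).take j = initialSegment x j := by
  apply List.ext_getElem
  · simp [h]
  · intro i h₁ h₂
    simp [initialSegment]

/-- A poset of subspaces with the legal moves (letters of `A`) of a block game at every finite
position, and a relation of inclusion up to finitely many dimensions which admits fusion. -/
structure BlockGame (A : Type u) (B : Type v) [Preorder B] where
  moves : B → List A → Set A
  height : A → ℕ
  almostLE : B → B → Prop
  moves_mono : ∀ {V W : B}, V ≤ W → ∀ l, moves V l ⊆ moves W l
  almostLE_refl : ∀ V, almostLE V V
  almostLE_of_le_of_almostLE : ∀ {U V W : B}, U ≤ V → almostLE V W → almostLE U W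
  exists_le_le : ∀ {V W : B}, almostLE V W → ∃ U, U ≤ V ∧ U ≤ W
  moves_of_almostLE : ∀ {V W : B}, almostLE V W →
    ∃ N, ∀ l, ∀ a ∈ moves V l, N ≤ height a → a ∈ moves W l
  fusion : ∀ V : ℕ → B, Antitone V → ∃ W, W ≤ V 0 ∧ ∀ n, almostLE W (V n)

namespace BlockGame

variable {A : Type u} {B : Type v} [Preorder B] (G : BlockGame A B)

theorem almostLE_of_le {V W : B} (h : V ≤ W) : G.almostLE V W :=
  G.almostLE_of_le_of_almostLE h (G.almostLE_refl W)

/-- Countably many hereditary properties can be decided simultaneously. -/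
theorem exists_le_forall_decided {ι : Type*} [Countable ι] (P : ι → B → Prop)
    (hP : ∀ i V W, G.almostLE V W → P i W → P i V) (V₀ : B) :
    ∃ W ≤ V₀, ∀ i, P i W ∨ ∀ V ≤ W, ¬ P i V := by
  rcases isEmpty_or_nonempty ι with hι | hι
  · exact ⟨V₀, le_rfl, fun i => hι.elim i⟩
  obtain ⟨g, hg⟩ := exists_surjective_nat ι
  have hstep : ∀ (n : ℕ) (V : B), ∃ V' ≤ V, (∃ U ≤ V, P (g n) U) → P (g n) V' := by
    intro n V
    by_cases h : ∃ U ≤ V, P (g n) U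
    · obtain ⟨U, hU, hPU⟩ := h
      exact ⟨U, hU, fun _ => hPU⟩
    · exact ⟨V, le_rfl, fun h' => absurd h' h⟩
  choose next hnext_le hnext using hstep
  let V : ℕ → B := fun n => Nat.rec V₀ next n
  obtain ⟨W, hW0, hW⟩ := G.fusion V (antitone_nat_of_succ_le fun n => hnext_le n (V n))
  refine ⟨W, hW0, fun i => ?_⟩
  obtain ⟨n, rfl⟩ := hg i
  rcases Classical.em (∃ U ≤ V n, P (g n) U) with h | h
  · exact Or.inl (hP _ _ _ (hW (n + 1)) (hnext n (V n) h))
  · refine Or.inr fun U hU hPU => h ?_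
    -- `U` is only almost below `V n`; a common lower bound inherits the property from `U` and
    -- contradicts the choice made at stage `n`.
    obtain ⟨U', hU'U, hU'V⟩ := G.exists_le_le (G.almostLE_of_le_of_almostLE hU (hW n))
    exact ⟨U', hU'V, hP _ _ _ (G.almostLE_of_le hU'U) hPU⟩

/-- The first player has a strategy in the asymptotic game of `V` from the position `l` which
avoids the set `S`. -/
def Avoids (V : B) (l : List A) (S : Set (ℕ → A)) : Prop :=
  ∃ φ : List A → ℕ, ∀ x : ℕ → A, initialSegment x l.length = l →
    (∀ k, l.length ≤ k → x k ∈ G.moves V (initialSegment x k) ∧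
      φ (initialSegment x k) ≤ G.height (x k)) → x ∉ S

/-- Beyond some height every move of `V` is a move of `W`, so the first player copies the strategy
for `W` and also demands that height. -/
theorem Avoids.of_almostLE {V W : B} {l : List A} {S : Set (ℕ → A)} (h : G.almostLE V W)
    (hW : G.Avoids W l S) : G.Avoids V l S := by
  obtain ⟨φ, hφ⟩ := hW
  obtain ⟨N, hN⟩ := G.moves_of_almostLE h
  refine ⟨fun l => max (φ l) N, fun x hx hk => hφ x hx fun k hlk => ?_⟩
  obtain ⟨h₁, h₂⟩ := hk k hlk
  exact ⟨hN _ _ h₁ (le_of_max_le_right h₂), le_of_max_le_left h₂⟩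

theorem exists_mem_of_not_avoids {V : B} {l : List A} {S : Set (ℕ → A)}
    (h : ¬ G.Avoids V l S) : ∃ x ∈ S, initialSegment x l.length = l := by
  by_contra! hcon
  exact h ⟨fun _ => 0, fun x hx _ hxS => hcon x hxS hx⟩

/-- The second player has a strategy of rank at most `α` in the Gowers game of `V` from the
position `l` which reaches `T` after at least one move. -/
def Reaches (V : B) (T : List A → Prop) (α : Ordinal.{v}) (l : List A) : Prop :=
  ∀ W ≤ V, ∃ a ∈ G.moves W l, T (l ++ [a]) ∨ ∃ β, ∃ _ : β < α, Reaches V T β (l ++ [a])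
termination_by α

theorem Reaches.of_almostLE {V W : B} {T : List A → Prop} (h : G.almostLE V W)
    (α : Ordinal.{v}) : ∀ l, G.Reaches W T α l → G.Reaches V T α l := by
  induction α using WellFoundedLT.induction with
  | ind α ih =>
    intro l hl
    rw [Reaches] at hl ⊢
    intro U hU
    obtain ⟨U', hU'U, hU'W⟩ := G.exists_le_le (G.almostLE_of_le_of_almostLE hU h)
    obtain ⟨a, ha, h⟩ := hl U' hU'W
    refine ⟨a, G.moves_mono hU'U _ ha, h.imp_right ?_⟩
    rintro ⟨β, hβ, hr⟩
    exact ⟨β, hβ, ih β hβ _ hr⟩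

/-- Ordinals live in the universe of `B`, so the ranks of the answers to all `W` are bounded. Hence
at an unranked position some `W` leaves only unranked answers outside `T`. -/
theorem exists_reaches {V : B} {T : List A → Prop} {l : List A}
    (h : ∀ W ≤ V, ∃ a ∈ G.moves W l, T (l ++ [a]) ∨ ∃ β, G.Reaches V T β (l ++ [a])) :
    ∃ α, G.Reaches V T α l := by
  have h' : ∀ W : B, ∃ β : Ordinal.{v}, W ≤ V → ∃ a ∈ G.moves W l,
      T (l ++ [a]) ∨ G.Reaches V T β (l ++ [a]) := by
    intro W
    by_cases hW : W ≤ V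
    · obtain ⟨a, ha, hT | ⟨β, hβ⟩⟩ := h W hW
      · exact ⟨0, fun _ => ⟨a, ha, Or.inl hT⟩⟩
      · exact ⟨β, fun _ => ⟨a, ha, Or.inr hβ⟩⟩
    · exact ⟨0, fun h => absurd h hW⟩
  choose β hβ using h'
  refine ⟨Order.succ (⨆ W, β W), ?_⟩
  rw [Reaches]
  intro W hW
  obtain ⟨a, ha, h⟩ := hβ W hW
  exact ⟨a, ha, h.imp_right fun h =>
    ⟨β W, Order.lt_succ_of_le (le_ciSup Ordinal.bddAbove_of_small W), h⟩⟩

/-- If `D` is preserved by all moves of sufficiently large height and each `S m` can be avoided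
after any such move, then the first player can avoid the union of the `S m` from every position
in `D`. -/
theorem avoids_iUnion {V : B} {S : ℕ → Set (ℕ → A)} (D : List A → Prop)
    (N : List A → ℕ) (l : List A) (hl : D l)
    (hD : ∀ l, D l → ∀ a ∈ G.moves V l, N l ≤ G.height a →
      D (l ++ [a]) ∧ ∀ m, G.Avoids V (l ++ [a]) (S m)) :
    G.Avoids V l (⋃ m, S m) := by
  classical
  have hφ : ∀ (l' : List A) (m : ℕ), ∃ φ : List A → ℕ, G.Avoids V l' (S m) →
      ∀ x : ℕ → A, initialSegment x l'.length = l' →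
        (∀ k, l'.length ≤ k → x k ∈ G.moves V (initialSegment x k) ∧
          φ (initialSegment x k) ≤ G.height (x k)) → x ∉ S m := by
    intro l' m
    by_cases h : G.Avoids V l' (S m)
    · obtain ⟨φ, hφ⟩ := h
      exact ⟨φ, fun _ => hφ⟩
    · exact ⟨fun _ => 0, fun h' => absurd h' h⟩
  choose φ hφ using hφ
  -- At `w`, obey the strategies against `S m` for all `m < w.length`, started at every prefix of
  -- `w`. They are finitely many, so a sum dominates them; `N` keeps the play in `D`.
  refine ⟨fun w => N w + ∑ j ∈ Finset.range (w.length + 1), ∑ m ∈ Finset.range w.length,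
    φ (w.take j) m w, fun x hx hk hxS => ?_⟩
  obtain ⟨m, hm⟩ := Set.mem_iUnion.1 hxS
  have hDx : ∀ k, l.length ≤ k → D (initialSegment x k) := by
    intro k hlk
    induction k, hlk using Nat.le_induction with
    | base => rwa [hx]
    | succ k hlk ih =>
      rw [initialSegment_succ]
      exact (hD _ ih _ (hk k hlk).1 ((Nat.le_add_right _ _).trans (hk k hlk).2)).1
  have hav : ∀ k, l.length ≤ k → G.Avoids V (initialSegment x (k + 1)) (S m) := by
    intro k hlk
    rw [initialSegment_succ]
    exact (hD _ (hDx k hlk) _ (hk k hlk).1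
      ((Nat.le_add_right _ _).trans (hk k hlk).2)).2 m
  -- From this length on, the index `m` occurs in the sums, so the play obeys the strategy against
  -- `S m` started here.
  refine hφ (initialSegment x (l.length + m + 1)) m (hav _ (Nat.le_add_right _ _)) x (by simp)
    (fun k hlk => ?_) hm
  rw [length_initialSegment] at hlk
  have hk' := hk k (by omega)
  refine ⟨hk'.1, le_trans ?_ hk'.2⟩
  refine le_trans ?_ (Nat.le_add_left _ _)
  have h₁ : φ (initialSegment x (l.length + m + 1)) m (initialSegment x k) ≤
      ∑ m' ∈ Finset.range (initialSegment x k).length,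
        φ ((initialSegment x k).take (l.length + m + 1)) m' (initialSegment x k) := by
    rw [take_initialSegment x hlk]
    exact Finset.single_le_sum
      (f := fun m' => φ (initialSegment x (l.length + m + 1)) m' (initialSegment x k))
      (fun _ _ => Nat.zero_le _) (by simp; omega)
  refine h₁.trans (Finset.single_le_sum (f := fun j => ∑ m' ∈ Finset.range
    (initialSegment x k).length, φ ((initialSegment x k).take j) m' (initialSegment x k))
      (fun _ _ => Nat.zero_le _) (by simp; omega))

/-- The Ramsey principle: for a Suslin scheme `S`, either the first player avoids `S []` in the
asymptotic game of some `W`, or the second player can go on forever in the Gowers game of `W`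
from one good pair to another with a longer second component. -/
theorem exists_avoids_or_reaches [Countable A] (S : List ℕ → Set (ℕ → A))
    (hS : ∀ s, S s ⊆ ⋃ m, S (s ++ [m])) (V₀ : B) :
    ∃ W ≤ V₀, G.Avoids W [] (S []) ∨ ∃ Good : List A → List ℕ → Prop, Good [] [] ∧
      ∀ l s, Good l s → (∃ x ∈ S s, initialSegment x l.length = l) ∧
        ∃ α, G.Reaches W (fun l' => ∃ m, Good l' (s ++ [m])) α l := by
  obtain ⟨W₁, hW₁, h₁⟩ := G.exists_le_forall_decided
    (fun (i : List A × List ℕ) V => G.Avoids V i.1 (S i.2))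
    (fun _ _ _ h => Avoids.of_almostLE G h) V₀
  let T : List ℕ → List A → Prop := fun s l => ∃ m, ¬ G.Avoids W₁ l (S (s ++ [m]))
  obtain ⟨W₂, hW₂, h₂⟩ := G.exists_le_forall_decided
    (fun (i : List A × List ℕ) V => ∃ α, G.Reaches V (T i.2) α i.1)
    (fun _ _ _ h => fun ⟨α, hα⟩ => ⟨α, Reaches.of_almostLE G h α _ hα⟩) W₁
  obtain ⟨W₃, hW₃, h₃⟩ := G.exists_le_forall_decided
    (fun (i : List A × List ℕ) V => ∃ N, ∀ a ∈ G.moves V i.1, N ≤ G.height a →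
      ¬ T i.2 (i.1 ++ [a]) ∧ ¬ ∃ α, G.Reaches W₂ (T i.2) α (i.1 ++ [a]))
    (fun _ _ _ h => fun ⟨N, hN⟩ => by
      obtain ⟨N', hN'⟩ := G.moves_of_almostLE h
      exact ⟨max N N', fun a ha hle => hN a (hN' _ _ ha (le_of_max_le_right hle))
        (le_of_max_le_left hle)⟩) W₂
  -- Otherwise every `W ≤ W₃` offers a move into `T s` or to a ranked position. Then `W₃` itself has
  -- a rank at `l`, against the decision made in `W₂`.
  have key : ∀ l s, (¬ ∃ α, G.Reaches W₂ (T s) α l) → ∃ N, ∀ a ∈ G.moves W₃ l,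
      N ≤ G.height a → ¬ T s (l ++ [a]) ∧ ¬ ∃ α, G.Reaches W₂ (T s) α (l ++ [a]) := by
    intro l s hls
    refine (h₃ (l, s)).resolve_right fun hcon => ?_
    refine ((h₂ (l, s)).resolve_left hls) W₃ hW₃ (G.exists_reaches fun W hW => ?_)
    have := hcon W hW
    push Not at this
    obtain ⟨a, ha, -, h⟩ := this 0
    refine ⟨a, ha, ?_⟩
    by_cases hT : T s (l ++ [a])
    · exact Or.inl hT
    · obtain ⟨α, hα⟩ := h hT
      exact Or.inr ⟨α, Reaches.of_almostLE G (G.almostLE_of_le hW₃) α _ hα⟩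
  choose! N hN using key
  -- From an unranked position, high moves stay unranked and leave every `S (s ++ [m])` avoidable;
  -- so their union, which contains `S s`, is avoidable.
  have hav : ∀ l s, (¬ ∃ α, G.Reaches W₂ (T s) α l) → G.Avoids W₃ l (S s) := by
    intro l s hls
    obtain ⟨φ, hφ⟩ := G.avoids_iUnion (V := W₃) (S := fun m => S (s ++ [m]))
      (fun l => ¬ ∃ α, G.Reaches W₂ (T s) α l) (fun l => N l s) l hls
      fun l' hl' a ha hle => by
        obtain ⟨hT, hR⟩ := hN l' s hl' a ha hle
        refine ⟨hR, fun m => ?_⟩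
        by_contra hcon
        exact hT ⟨m, fun h => hcon (Avoids.of_almostLE G
          (G.almostLE_of_le (hW₃.trans hW₂)) h)⟩
    exact ⟨φ, fun x hx hk hxS => hφ x hx hk (hS s hxS)⟩
  refine ⟨W₃, hW₃.trans (hW₂.trans hW₁), ?_⟩
  by_cases h0 : G.Avoids W₁ [] (S [])
  · exact Or.inl (Avoids.of_almostLE G (G.almostLE_of_le (hW₃.trans hW₂)) h0)
  · refine Or.inr ⟨fun l s => ¬ G.Avoids W₁ l (S s), h0, fun l s hls =>
      ⟨G.exists_mem_of_not_avoids hls, ?_⟩⟩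
    -- By the choice of `W₁`, a pair not avoided there is avoided in no smaller subspace, so `hav`
    -- forces a rank.
    have hR : ∃ α, G.Reaches W₂ (T s) α l := by
      by_contra hcon
      exact (h₁ (l, s)).resolve_left hls W₃ (hW₃.trans hW₂) (hav l s hcon)
    obtain ⟨α, hα⟩ := hR
    exact ⟨α, Reaches.of_almostLE G (G.almostLE_of_le hW₃) α _ hα⟩

end BlockGame

end AbstractGame

/-! ### Supports, block sequences, fusion and gaps of block subspaces. -/

section BlockVectors

variable {𝕜 E : Type*} [RCLike 𝕜] [AddCommGroup E] [Module 𝕜 E] (e : Module.Basis ℕ 𝕜 E)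

/-- The support of `x` lies to the left of the support of `y`. -/
def Precedes (x y : E) : Prop := ∀ i j, e.repr x i ≠ 0 → e.repr y j ≠ 0 → i < j

theorem mem_span_image_iff_repr {s : Set ℕ} {x : E} :
    x ∈ Submodule.span 𝕜 (e '' s) ↔ ∀ i, e.repr x i ≠ 0 → i ∈ s := by
  rw [Module.Basis.mem_span_image]
  simp [Set.subset_def]

theorem exists_repr_ne_zero {x : E} (hx : x ≠ 0) : ∃ i, e.repr x i ≠ 0 := by
  by_contra! h
  exact hx (e.repr.map_eq_zero_iff.1 (Finsupp.ext h))

theorem exists_forall_repr_lt (x : E) : ∃ N, ∀ i, e.repr x i ≠ 0 → i < N :=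
  ⟨(e.repr x).support.sup id + 1, fun _ hi =>
    Nat.lt_succ_of_le (Finset.le_sup (f := id) (Finsupp.mem_support_iff.2 hi))⟩

theorem exists_forall_mem_repr_lt (s : Finset E) :
    ∃ N, ∀ x ∈ s, ∀ i, e.repr x i ≠ 0 → i < N := by
  choose N hN using exists_forall_repr_lt e
  exact ⟨s.sup N, fun x hx i hi => (hN x i hi).trans_le (Finset.le_sup hx)⟩

theorem exists_max_repr {x : E} (hx : x ≠ 0) :
    ∃ i, e.repr x i ≠ 0 ∧ ∀ j, e.repr x j ≠ 0 → j ≤ i := by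
  have h : (e.repr x).support.Nonempty := by
    obtain ⟨i, hi⟩ := exists_repr_ne_zero e hx
    exact ⟨i, Finsupp.mem_support_iff.2 hi⟩
  exact ⟨_, Finsupp.mem_support_iff.1 (Finset.max'_mem _ h),
    fun j hj => Finset.le_max' _ _ (Finsupp.mem_support_iff.2 hj)⟩

theorem exists_min_repr {x : E} (hx : x ≠ 0) :
    ∃ i, e.repr x i ≠ 0 ∧ ∀ j, e.repr x j ≠ 0 → i ≤ j := by
  have h : (e.repr x).support.Nonempty := by
    obtain ⟨i, hi⟩ := exists_repr_ne_zero e hx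
    exact ⟨i, Finsupp.mem_support_iff.2 hi⟩
  exact ⟨_, Finsupp.mem_support_iff.1 (Finset.min'_mem _ h),
    fun j hj => Finset.min'_le _ _ (Finsupp.mem_support_iff.2 hj)⟩

/-- The cut points can be recovered from the vectors: after `0`, each is one more than the last
index of a support. -/
theorem isBlockSeq_iff {v : ℕ → E} :
    IsBlockSeq e v ↔ (∀ k, v k ≠ 0) ∧ ∀ k l, k < l → Precedes e (v k) (v l) := by
  constructor
  · rintro ⟨p, -, hp, hv⟩
    refine ⟨fun k => (hv k).1, fun k l hkl i j hi hj => ?_⟩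
    have h₁ := (mem_span_image_iff_repr e).1 (hv k).2 i hi
    have h₂ := (mem_span_image_iff_repr e).1 (hv l).2 j hj
    exact h₁.2.trans_le ((hp.monotone hkl).trans h₂.1)
  · rintro ⟨h0, hlt⟩
    choose t ht hmax using fun k => exists_max_repr e (h0 k)
    have hstep : ∀ k j, e.repr (v (k + 1)) j ≠ 0 → t k + 1 ≤ j := fun k j hj =>
      hlt k (k + 1) k.lt_succ_self _ _ (ht k) hj
    refine ⟨fun k => Nat.casesOn k 0 fun k => t k + 1, rfl,
      strictMono_nat_of_lt_succ fun k => ?_, fun k => ⟨h0 k, ?_⟩⟩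
    · cases k with
      | zero => exact Nat.succ_pos _
      | succ k => exact Nat.lt_succ_of_le (hstep k _ (ht (k + 1)))
    · refine (mem_span_image_iff_repr e).2 fun i hi => ⟨?_, Nat.lt_succ_of_le (hmax k i hi)⟩
      cases k with
      | zero => exact Nat.zero_le _
      | succ k => exact hstep k i hi

theorem isBlockList_of_pairwise {l : List E} (h0 : ∀ x ∈ l, x ≠ 0)
    (hl : l.Pairwise (Precedes e)) : IsBlockList e l := by
  classical
  obtain ⟨N, hN⟩ := exists_forall_mem_repr_lt e l.toFinset
  -- Basis vectors beyond all supports prolong the list, so the infinite case supplies the cut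
  -- points.
  have hseq : IsBlockSeq e fun k => if h : k < l.length then l[k] else e (N + k) := by
    refine (isBlockSeq_iff e).2 ⟨fun k => ?_, fun k m hkm i j hi hj => ?_⟩
    · by_cases hk : k < l.length
      · simpa [hk] using h0 _ (List.getElem_mem hk)
      · simpa [hk] using e.ne_zero (N + k)
    · by_cases hm : m < l.length
      · have hk : k < l.length := hkm.trans hm
        simp only [hm, hk, dite_true] at hi hj
        exact List.pairwise_iff_getElem.1 hl k m hk hm hkm i j hi hj
      · simp only [hm, dite_false, Module.Basis.repr_self, Finsupp.single_apply, ne_eq,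
          ite_eq_right_iff, not_forall] at hj
        obtain ⟨rfl, -⟩ := hj
        by_cases hk : k < l.length
        · simp only [hk, dite_true] at hi
          exact (hN _ (List.mem_toFinset.2 (List.getElem_mem hk)) i hi).trans_le
            (Nat.le_add_right _ _)
        · simp only [hk, dite_false, Module.Basis.repr_self, Finsupp.single_apply, ne_eq,
            ite_eq_right_iff, not_forall] at hi
          obtain ⟨rfl, -⟩ := hi
          omega
  obtain ⟨p, hp0, hp, hv⟩ := hseq
  refine ⟨p, hp0, hp, fun k hk => ?_⟩
  simpa [hk] using hv k

variable {e}

/-- The expansion of a vector of the span of successive vectors. -/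
theorem exists_coeff_of_mem_span {v : ℕ → E} (hv : ∀ k l, k < l → Precedes e (v k) (v l))
    {y : E} (hy : y ∈ Submodule.span 𝕜 (Set.range v)) :
    ∃ c : ℕ →₀ 𝕜, y = c.sum (fun m a => a • v m) ∧
      (∀ r i, e.repr (v r) i ≠ 0 → e.repr y i = c r * e.repr (v r) i) ∧
      ∀ i, e.repr y i ≠ 0 → ∃ r, e.repr (v r) i ≠ 0 := by
  obtain ⟨c, rfl⟩ := Finsupp.mem_span_range_iff_exists_finsupp.1 hy
  have hrepr : ∀ i, e.repr (c.sum fun m a => a • v m) i =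
      ∑ m ∈ c.support, c m * e.repr (v m) i := by
    intro i
    simp [Finsupp.sum, Finsupp.finsetSum_apply]
  refine ⟨c, rfl, fun r i hi => ?_, fun i hi => ?_⟩
  · rw [hrepr, Finset.sum_eq_single r]
    · intro m _ hmr
      by_contra hne
      have hm : e.repr (v m) i ≠ 0 := right_ne_zero_of_mul hne
      rcases lt_or_gt_of_ne hmr with h | h
      · exact lt_irrefl _ (hv m r h i i hm hi)
      · exact lt_irrefl _ (hv r m h i i hi hm)
    · intro hr
      simp [Finsupp.notMem_support_iff.1 hr]
  · rw [hrepr] at hi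
    obtain ⟨r, -, hr⟩ := Finset.exists_ne_zero_of_sum_ne_zero hi
    exact ⟨r, right_ne_zero_of_mul hr⟩

/-- If `v m` has a nonzero coefficient in `y`, its support is contained in that of `y`, hence starts
at `N` or later, which excludes `m < n`. -/
theorem mem_span_image_Ici {v : ℕ → E} (h0 : ∀ k, v k ≠ 0)
    (hv : ∀ k l, k < l → Precedes e (v k) (v l)) {y : E}
    (hy : y ∈ Submodule.span 𝕜 (Set.range v)) {n N : ℕ}
    (hN : ∀ m < n, ∀ i, e.repr (v m) i ≠ 0 → i < N) (hyN : ∀ i, e.repr y i ≠ 0 → N ≤ i) :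
    y ∈ Submodule.span 𝕜 (v '' Set.Ici n) := by
  obtain ⟨c, hc, hrep, -⟩ := exists_coeff_of_mem_span hv hy
  rw [hc]
  refine Submodule.sum_mem _ fun m hm => Submodule.smul_mem _ _ (Submodule.subset_span
    ⟨m, ?_, rfl⟩)
  by_contra hmn
  obtain ⟨i, hi⟩ := exists_repr_ne_zero e (h0 m)
  have hyi : e.repr y i ≠ 0 := by
    rw [hrep m i hi]
    exact mul_ne_zero (Finsupp.mem_support_iff.1 hm) hi
  exact absurd (hN m (not_le.1 hmn) i hi) (not_lt.2 (hyN i hyi))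

theorem exists_precedes_of_span {v : ℕ → E} (hv : ∀ k l, k < l → Precedes e (v k) (v l))
    {x y : E} (hx : x ∈ Submodule.span 𝕜 (Set.range v))
    (hy : y ∈ Submodule.span 𝕜 (Set.range v)) (hxy : Precedes e x y) {i j : ℕ}
    (hi : e.repr x i ≠ 0) (hj : e.repr y j ≠ 0) :
    ∃ r s, r < s ∧ e.repr (v r) i ≠ 0 ∧ e.repr (v s) j ≠ 0 := by
  obtain ⟨c, -, hcx, hx'⟩ := exists_coeff_of_mem_span hv hx
  obtain ⟨-, -, -, hy'⟩ := exists_coeff_of_mem_span hv hy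
  obtain ⟨r, hr⟩ := hx' i hi
  obtain ⟨s, hs⟩ := hy' j hj
  refine ⟨r, s, ?_, hr, hs⟩
  have hij : i < j := hxy i j hi hj
  rcases lt_trichotomy r s with h | rfl | h
  · exact h
  -- If `i` and `j` lie in the support of the same `v r`, the nonzero coefficient of `v r` in `x`
  -- puts `j` in the support of `x` as well.
  · have hc : c r ≠ 0 := left_ne_zero_of_mul (hcx r i hr ▸ hi)
    have : e.repr x j ≠ 0 := by
      rw [hcx r j hs]
      exact mul_ne_zero hc hs
    exact absurd (hxy j j this hj) (lt_irrefl _)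
  · exact absurd (hv s r h j i hs hr) hij.le.not_gt

theorem isBlockSubspace_span {v : ℕ → E} (h0 : ∀ k, v k ≠ 0)
    (hv : ∀ k l, k < l → Precedes e (v k) (v l)) :
    IsBlockSubspace e (Submodule.span 𝕜 (Set.range v)) :=
  ⟨v, (isBlockSeq_iff e).2 ⟨h0, hv⟩, rfl⟩

theorem IsBlockSubspace.exists_mem_tail {V : Submodule 𝕜 E} (hV : IsBlockSubspace e V) (N : ℕ) :
    ∃ y ∈ V, y ≠ 0 ∧ ∀ i, e.repr y i ≠ 0 → N ≤ i := by
  obtain ⟨v, ⟨p, -, hp, hv⟩, rfl⟩ := hV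
  exact ⟨v N, Submodule.subset_span ⟨N, rfl⟩, (hv N).1, fun i hi =>
    (hp.id_le N).trans ((mem_span_image_iff_repr e).1 (hv N).2 i hi).1⟩

instance : Preorder (BlockSubspace e) := Preorder.lift Subtype.val

/-- The `k`-th vector of a diagonal block sequence is taken in some `V m` with `m ≥ k`, and vectors
of its span supported far enough lie in the span of a tail. -/
theorem BlockSubspace.exists_fusion (V : ℕ → BlockSubspace e) (hV : Antitone V) :
    ∃ W : BlockSubspace e, W ≤ V 0 ∧
      ∀ n, ∃ N, ∀ y ∈ W.1, (∀ i, e.repr y i ≠ 0 → N ≤ i) → y ∈ (V n).1 := by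
  classical
  obtain ⟨f, hf, hlt⟩ := exists_seq_of_forall_finset_exists
    (fun x : ℕ × E => x.2 ∈ (V x.1).1 ∧ x.2 ≠ 0)
    (fun x y => x.1 < y.1 ∧ Precedes e x.2 y.2) (by
      intro s _
      obtain ⟨N, hN⟩ := exists_forall_mem_repr_lt e (s.image Prod.snd)
      obtain ⟨y, hy, hy0, hyN⟩ := (V (s.sup Prod.fst + 1)).2.exists_mem_tail N
      exact ⟨(_, y), ⟨hy, hy0⟩, fun x hx => ⟨Nat.lt_succ_of_le (Finset.le_sup hx),
        fun i j hi hj => (hN _ (Finset.mem_image_of_mem _ hx) i hi).trans_le (hyN j hj)⟩⟩)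
  have hmono : StrictMono fun k => (f k).1 := fun m n hmn => (hlt m n hmn).1
  have hmem : ∀ n k, n ≤ k → (f k).2 ∈ (V n).1 := fun n k hnk =>
    hV (hnk.trans (hmono.id_le k)) (hf k).1
  have h0 : ∀ k, (f k).2 ≠ 0 := fun k => (hf k).2
  have hprec : ∀ k l, k < l → Precedes e (f k).2 (f l).2 := fun k l hkl => (hlt k l hkl).2
  refine ⟨⟨_, isBlockSubspace_span h0 hprec⟩, ?_, fun n => ?_⟩
  · refine Submodule.span_le.2 ?_
    rintro _ ⟨k, rfl⟩
    exact hmem 0 k (Nat.zero_le k)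
  · obtain ⟨N, hN⟩ := exists_forall_mem_repr_lt e
      ((Finset.range n).image fun k => (f k).2)
    refine ⟨N, fun y hy hyN => ?_⟩
    refine Submodule.span_le.2 ?_ (mem_span_image_Ici h0 hprec hy (n := n) (N := N)
      (fun m hm => hN _ (Finset.mem_image_of_mem _ (Finset.mem_range.2 hm))) hyN)
    rintro _ ⟨k, hk, rfl⟩
    exact hmem n k hk

/-- Every block subspace contains a block subspace in which successive vectors have gaps
prescribed by `ψ`. -/
theorem BlockSubspace.exists_le_gaps (V : BlockSubspace e) (N : ℕ) (ψ : ℕ → ℕ) :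
    ∃ W : BlockSubspace e, W ≤ V ∧ (∀ y ∈ W.1, ∀ i, e.repr y i ≠ 0 → N ≤ i) ∧
      ∀ x ∈ W.1, ∀ y ∈ W.1, Precedes e x y → ∀ i j, e.repr x i ≠ 0 → e.repr y j ≠ 0 →
        ψ i ≤ j := by
  classical
  obtain ⟨f, hf, hlt⟩ := exists_seq_of_forall_finset_exists
    (fun x : E => x ∈ V.1 ∧ x ≠ 0 ∧ ∀ i, e.repr x i ≠ 0 → N ≤ i)
    (fun x y => Precedes e x y ∧ ∀ i j, e.repr x i ≠ 0 → e.repr y j ≠ 0 → ψ i ≤ j) (by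
      intro s _
      obtain ⟨M, hM⟩ := exists_forall_mem_repr_lt e s
      obtain ⟨y, hy, hy0, hyN⟩ := V.2.exists_mem_tail (M + N + (Finset.range M).sup ψ)
      refine ⟨y, ⟨hy, hy0, fun i hi => ?_⟩, fun x hx => ⟨fun i j hi hj => ?_,
        fun i j hi hj => ?_⟩⟩
      · have := hyN i hi
        omega
      · have := hyN j hj
        have := hM x hx i hi
        omega
      · have h₁ := hyN j hj
        have h₂ : ψ i ≤ (Finset.range M).sup ψ :=
          Finset.le_sup (Finset.mem_range.2 (hM x hx i hi))
        omega)
  have h0 : ∀ k, f k ≠ 0 := fun k => (hf k).2.1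
  have hprec : ∀ k l, k < l → Precedes e (f k) (f l) := fun k l hkl => (hlt k l hkl).1
  refine ⟨⟨_, isBlockSubspace_span h0 hprec⟩, Submodule.span_le.2 ?_, fun y hy i hi => ?_,
    fun x hx y hy hxy i j hi hj => ?_⟩
  · rintro _ ⟨k, rfl⟩
    exact (hf k).1
  · obtain ⟨-, -, -, h⟩ := exists_coeff_of_mem_span hprec hy
    obtain ⟨r, hr⟩ := h i hi
    exact (hf r).2.2 i hr
  · obtain ⟨r, s, hrs, hr, hs⟩ := exists_precedes_of_span hprec hx hy hxy hi hj
    exact (hlt r s hrs).2 i j hr hs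

end BlockVectors

/-! ### Countably many boxes, compactness, and smallness of `F`-norms. -/

section Cells

variable {𝕜 E : Type*} [RCLike 𝕜] [AddCommGroup E] [Module 𝕜 E] (e : Module.Basis ℕ 𝕜 E)

/-- Codes `(a, b, c)` of boxes of vectors supported in the interval `[a, b)`. -/
abbrev BlockLetter : Type := ℕ × ℕ × (ℕ →₀ ℕ)

/-- The box coded by a letter, with side lengths given by `δ`. -/
def cell (δ : ℕ → ℝ) (a : BlockLetter) : Set E :=
  {y | (∀ i, a.1 ≤ i → i < a.2.1 →
      ‖e.repr y i - TopologicalSpace.denseSeq 𝕜 (a.2.2 i)‖ ≤ δ i) ∧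
    ∀ i, ¬ (a.1 ≤ i ∧ i < a.2.1) → e.repr y i = 0}

variable {e}

theorem mem_Ico_of_mem_cell {δ : ℕ → ℝ} {a : BlockLetter} {y : E} (hy : y ∈ cell e δ a) {i : ℕ}
    (hi : e.repr y i ≠ 0) : a.1 ≤ i ∧ i < a.2.1 := by
  by_contra h
  exact hi (hy.2 i h)

theorem norm_repr_sub_le_of_mem_cell {δ : ℕ → ℝ} (hδ : ∀ i, 0 < δ i) {a : BlockLetter} {y v : E}
    (hy : y ∈ cell e δ a) (hv : v ∈ cell e δ a) (i : ℕ) :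
    ‖e.repr (y - v) i‖ ≤ 2 * δ i := by
  rw [map_sub, Finsupp.sub_apply]
  by_cases h : a.1 ≤ i ∧ i < a.2.1
  · have h₁ := hy.1 i h.1 h.2
    have h₂ := hv.1 i h.1 h.2
    rw [← sub_sub_sub_cancel_right _ _ (TopologicalSpace.denseSeq 𝕜 (a.2.2 i))]
    exact (norm_sub_le _ _).trans (by linarith)
  · rw [hy.2 i h, hv.2 i h, sub_zero, norm_zero]
    linarith [hδ i]

/-- A set with compact finite-dimensional sections is covered, on each interval of the basis, by
finitely many cells. -/
theorem IsFinDimCompact.exists_finset_letters {C : Set E} (hC : IsFinDimCompact 𝕜 C)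
    {δ : ℕ → ℝ} (hδ : ∀ i, 0 < δ i) (a b : ℕ) :
    ∃ t : Finset BlockLetter, (∀ l ∈ t, l.1 = a ∧ l.2.1 = b) ∧
      ∀ y ∈ C, (∀ i, e.repr y i ≠ 0 → a ≤ i ∧ i < b) → ∃ l ∈ t, y ∈ cell e δ l := by
  classical
  let F : Submodule 𝕜 E := Submodule.span 𝕜 (e '' Set.Ico a b)
  have hF : FiniteDimensional 𝕜 F :=
    FiniteDimensional.span_of_finite 𝕜 ((Set.finite_Ico a b).image e)
  let _ : TopologicalSpace F := moduleTopology 𝕜 F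
  have _ : IsModuleTopology 𝕜 F := ⟨rfl⟩
  -- The open versions of the cells, with strict inequalities, to which compactness applies.
  let U : (ℕ →₀ ℕ) → Set F := fun c =>
    ⋂ i ∈ Finset.Ico a b, {x : F | ‖e.repr x i - TopologicalSpace.denseSeq 𝕜 (c i)‖ < δ i}
  have hcont : ∀ i, Continuous fun x : F => e.repr (x : E) i := fun i =>
    IsModuleTopology.continuous_of_linearMap (R := 𝕜) ((e.coord i).comp F.subtype)
  have hU : ∀ c, IsOpen (U c) := fun c => isOpen_biInter_finset fun i _ =>
    isOpen_lt ((hcont i).sub continuous_const).norm continuous_const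
  have hcover : {x : F | (x : E) ∈ C} ⊆ ⋃ c, U c := by
    intro x _
    have hd : ∀ i, ∃ m, ‖e.repr (x : E) i - TopologicalSpace.denseSeq 𝕜 m‖ < δ i := fun i => by
      obtain ⟨m, hm⟩ := (TopologicalSpace.denseRange_denseSeq 𝕜).exists_dist_lt
        (e.repr (x : E) i) (hδ i)
      exact ⟨m, by rwa [← dist_eq_norm]⟩
    choose m hm using hd
    refine Set.mem_iUnion.2 ⟨Finsupp.onFinset (Finset.Ico a b)
      (fun i => if i ∈ Finset.Ico a b then m i else 0) (fun i hi => by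
        by_contra h
        exact hi (if_neg h)), ?_⟩
    refine Set.mem_iInter₂.2 fun i hi => ?_
    simp only [Finsupp.onFinset_apply, if_pos hi, Set.mem_ofPred_eq]
    exact hm i
  obtain ⟨t, ht⟩ := (hC F hF).elim_finite_subcover U hU hcover
  refine ⟨t.image fun c => (a, b, c), ?_, fun y hy hsupp => ?_⟩
  · simp only [Finset.mem_image]
    rintro _ ⟨c, -, rfl⟩
    exact ⟨rfl, rfl⟩
  · have hyF : y ∈ F := (mem_span_image_iff_repr e).2 hsupp
    obtain ⟨c, hc, hyc⟩ := Set.mem_iUnion₂.1 (@ht ⟨y, hyF⟩ hy)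
    refine ⟨_, Finset.mem_image_of_mem _ hc, fun i h₁ h₂ => ?_, fun i hi => ?_⟩
    · exact (Set.mem_iInter₂.1 hyc i (Finset.mem_Ico.2 ⟨h₁, h₂⟩)).le
    · by_contra h
      exact hi (hsupp i h)

theorem continuous_repr_apply_intrinsicTopology (i : ℕ) :
    @Continuous E 𝕜 (intrinsicTopology 𝕜 E) _ fun x => e.repr x i := by
  let _ : TopologicalSpace E := intrinsicTopology 𝕜 E
  refine continuous_def.2 fun U hU F _ => ?_
  let _ : TopologicalSpace F := moduleTopology 𝕜 F
  have _ : IsModuleTopology 𝕜 F := ⟨rfl⟩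
  exact hU.preimage
    (IsModuleTopology.continuous_of_linearMap (R := 𝕜) ((e.coord i).comp F.subtype))

theorem continuous_repr_apply_sigmaInfTopology (n i : ℕ) :
    @Continuous (SigmaInf e) 𝕜 (sigmaInfTopology e) _ fun u => e.repr ((u : ℕ → E) n) i := by
  let _ : TopologicalSpace E := intrinsicTopology 𝕜 E
  exact (continuous_repr_apply_intrinsicTopology i).comp
    ((continuous_apply n).comp continuous_subtype_val)

/-- A nonempty analytic set of block bases is parametrized by the Baire space, in such a way that
all coordinates are continuous. -/
theorem IsAnalyticInSigmaInf.exists_parametrization {σ : Set (ℕ → E)} (hσ : σ ⊆ SigmaInf e)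
    (h : IsAnalyticInSigmaInf e σ) (hne : σ.Nonempty) :
    ∃ f : (ℕ → ℕ) → ℕ → E, Set.range f = σ ∧
      ∀ n i, Continuous fun z => e.repr (f z n) i := by
  let _ := sigmaInfTopology e
  obtain ⟨u, hu⟩ := hne
  rw [IsAnalyticInSigmaInf, MeasureTheory.AnalyticSet] at h
  rcases h with h | ⟨g, hg, hrange⟩
  · exact absurd (h.subset (show (⟨u, hσ hu⟩ : SigmaInf e) ∈ _ from hu)) (Set.notMem_empty _)
  · refine ⟨fun z => g z, ?_, fun n i =>
      (continuous_repr_apply_sigmaInfTopology n i).comp hg⟩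
    ext v
    constructor
    · rintro ⟨z, rfl⟩
      exact hrange.subset ⟨z, rfl⟩
    · intro hv
      obtain ⟨z, hz⟩ := hrange.superset (show (⟨v, hσ hv⟩ : SigmaInf e) ∈ _ from hv)
      exact ⟨z, congrArg Subtype.val hz⟩

/-- An `F`-norm is small on a suitable box. -/
theorem IsFNorm.exists_box {ρ : E → ℝ} (hρ : IsFNorm 𝕜 ρ) (e : Module.Basis ℕ 𝕜 E) {η : ℝ}
    (hη : 0 < η) :
    ∃ d : ℕ → ℝ, (∀ i, 0 < d i) ∧ ∀ x, (∀ i, ‖e.repr x i‖ ≤ d i) → ρ x ≤ η := by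
  obtain ⟨η', hη', c, hc, hcη⟩ := posSumOfEncodable hη ℕ
  have hd : ∀ i, ∃ d : ℝ, 0 < d ∧ ∀ a : 𝕜, ‖a‖ ≤ d → ρ (a • e i) ≤ η' i := by
    intro i
    obtain ⟨d, hd, h⟩ := Metric.eventually_nhds_iff.1
      ((hρ.tendsto_smul (e i)).eventually_lt_const (hη' i))
    refine ⟨d / 2, half_pos hd, fun a ha => (h ?_).le⟩
    rw [dist_zero_right]
    linarith
  choose d hd0 hd using hd
  refine ⟨d, hd0, fun x hx => ?_⟩
  have hsum : ∀ s : Finset ℕ, ρ (∑ i ∈ s, e.repr x i • e i) ≤ ∑ i ∈ s, η' i := by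
    intro s
    induction s using Finset.induction_on with
    | empty => simp [hρ.map_zero]
    | insert i s hi ih =>
      rw [Finset.sum_insert hi, Finset.sum_insert hi]
      exact (hρ.add_le _ _).trans (add_le_add (hd i _ (hx i)) ih)
  have hx' := hsum (e.repr x).support
  rw [show ∑ i ∈ (e.repr x).support, e.repr x i • e i = x from e.linearCombination_repr x] at hx'
  exact hx'.trans ((sum_le_hasSum _ (fun i _ => (hη' i).le) hc).trans hcη)

/-- The factor `2` allows for two points of one box with half-widths `δ n i`; aiming at `ε / 2`
makes the final inequality strict. -/
theorem exists_box_blockDist_lt {ρ : ℕ → E → ℝ} (hρ : ∀ n, IsFNorm 𝕜 (ρ n))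
    (e : Module.Basis ℕ 𝕜 E) {ε : ℝ} (hε : 0 < ε) :
    ∃ δ : ℕ → ℕ → ℝ, (∀ n i, 0 < δ n i) ∧ ∀ u v : ℕ → E,
      (∀ n i, ‖e.repr (u n - v n) i‖ ≤ 2 * δ n i) → blockDist ρ u v < ENNReal.ofReal ε := by
  obtain ⟨η, hη, c, hc, hcε⟩ := posSumOfEncodable (half_pos hε) ℕ
  choose d hd0 hd using fun n => (hρ n).exists_box e (hη n)
  refine ⟨fun n i => d n i / 2, fun n i => half_pos (hd0 n i), fun u v h => ?_⟩
  calc blockDist ρ u v ≤ ∑' n, ENNReal.ofReal (η n) :=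
        ENNReal.tsum_le_tsum fun n => ENNReal.ofReal_le_ofReal
          (hd n _ fun i => (h n i).trans_eq (by ring))
    _ = ENNReal.ofReal c := by
        rw [← ENNReal.ofReal_tsum_of_nonneg (fun n => (hη n).le) hc.summable, hc.tsum_eq]
    _ ≤ ENNReal.ofReal (ε / 2) := ENNReal.ofReal_le_ofReal hcε
    _ < ENNReal.ofReal ε := (ENNReal.ofReal_lt_ofReal_iff hε).2 (half_lt_self hε)

end Cells

/-! ### The game of cells, and strategies built from transition systems. -/

section GameOfCells

variable {𝕜 E : Type*} [RCLike 𝕜] [AddCommGroup E] [Module 𝕜 E] (e : Module.Basis ℕ 𝕜 E)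

/-- The game in which the second player plays boxes which meet the given block subspace. -/
def cellGame (δ : ℕ → ℕ → ℝ) : BlockGame BlockLetter (BlockSubspace e) where
  moves V l := {a | (∀ b ∈ l, b.2.1 ≤ a.1) ∧ ∃ y ∈ V.1, y ≠ 0 ∧ y ∈ cell e (δ l.length) a}
  height a := a.1
  almostLE V W := ∃ N, ∀ y ∈ V.1, (∀ i, e.repr y i ≠ 0 → N ≤ i) → y ∈ W.1
  moves_mono := fun h _ _ ⟨h₁, y, hy, h₂⟩ => ⟨h₁, y, h hy, h₂⟩
  almostLE_refl _ := ⟨0, fun _ hy _ => hy⟩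
  almostLE_of_le_of_almostLE := fun h ⟨N, hN⟩ => ⟨N, fun y hy => hN y (h hy)⟩
  exists_le_le := by
    rintro V W ⟨N, hN⟩
    obtain ⟨U, hUV, hU, -⟩ := V.exists_le_gaps N id
    exact ⟨U, hUV, fun y hy => hN y (hUV hy) (hU y hy)⟩
  moves_of_almostLE := by
    rintro V W ⟨N, hN⟩
    refine ⟨N, fun l a ⟨h₁, y, hy, h0, hya⟩ hle => ⟨h₁, y, hN y hy fun i hi => ?_, h0, hya⟩⟩
    exact hle.trans (mem_Ico_of_mem_cell hya hi).1
  fusion := BlockSubspace.exists_fusion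

/-- The sequences of letters whose boxes contain, term by term, a sequence `f z` with `z`
extending `s`. -/
def cellScheme (δ : ℕ → ℕ → ℝ) (f : (ℕ → ℕ) → ℕ → E) (s : List ℕ) : Set (ℕ → BlockLetter) :=
  {x | ∃ z, initialSegment z s.length = s ∧ ∀ n, f z n ∈ cell e (δ n) (x n)}

theorem cellScheme_subset_iUnion (δ : ℕ → ℕ → ℝ) (f : (ℕ → ℕ) → ℕ → E) (s : List ℕ) :
    cellScheme e δ f s ⊆ ⋃ m, cellScheme e δ f (s ++ [m]) := by
  rintro x ⟨z, hz, hx⟩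
  refine Set.mem_iUnion.2 ⟨z s.length, z, ?_, hx⟩
  rw [List.length_append, List.length_singleton, initialSegment_succ, hz]

variable {e}

theorem finite_setOf_length_le_forall_mem {α : Type*} (t : Finset α) (n : ℕ) :
    {l : List α | l.length ≤ n ∧ ∀ a ∈ l, a ∈ t}.Finite := by
  refine ((List.finite_length_le (↥t) n).image (List.map Subtype.val)).subset ?_
  rintro l ⟨hl, hmem⟩
  exact ⟨l.attach.map fun a => ⟨a.1, hmem a.1 a.2⟩, by simpa using hl, by
    simp [Function.comp_def]⟩

theorem not_avoids_cellScheme {σ : Set (ℕ → E)} (hlarge : IsLarge e σ) {C : ℕ → Set E}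
    (hC : ∀ n, IsFinDimCompact 𝕜 (C n)) (hσC : σ ⊆ Set.univ.pi C) {δ : ℕ → ℕ → ℝ}
    (hδ : ∀ n i, 0 < δ n i) {f : (ℕ → ℕ) → ℕ → E} (hf : Set.range f = σ)
    (W : BlockSubspace e) : ¬ (cellGame e δ).Avoids W [] (cellScheme e δ f []) := by
  classical
  rintro ⟨φ, hφ⟩
  choose t ht htC using fun n => (hC n).exists_finset_letters (e := e) (hδ n)
  -- For each `M` there are only finitely many such lists, since each `t n i j` is finite.
  have hψ : ∀ M, ∃ B, ∀ l : List BlockLetter, l.length ≤ M →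
      (∀ a ∈ l, ∃ n ≤ M, ∃ i ≤ M, ∃ j ≤ M, a ∈ t n i j) → φ l ≤ B := by
    intro M
    let R := Finset.range (M + 1)
    obtain ⟨B, hB⟩ := ((finite_setOf_length_le_forall_mem
      (R.biUnion fun n => R.biUnion fun i => R.biUnion fun j => t n i j) M).image φ).bddAbove
    refine ⟨B, fun l hl hmem => hB ⟨l, ⟨hl, fun a ha => ?_⟩, rfl⟩⟩
    obtain ⟨n, hn, i, hi, j, hj, h⟩ := hmem a ha
    simp only [Finset.mem_biUnion]
    exact ⟨n, Finset.mem_range_succ_iff.2 hn, i, Finset.mem_range_succ_iff.2 hi, j,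
      Finset.mem_range_succ_iff.2 hj, h⟩
  choose ψ hψ using hψ
  -- With `i` the last index of a support, `i + 1` is the right end of its letter and bounds the
  -- length and all parameters of the position. The demand `φ []` governs the first move.
  obtain ⟨W', hW', hN, hgap⟩ := W.exists_le_gaps (φ []) fun i => ψ (i + 1)
  obtain ⟨v, hvσ, hv, hvW⟩ := hlarge W'.1 W'.2
  obtain ⟨h0, hprec⟩ := (isBlockSeq_iff e).1 hv
  choose p hp hpmin using fun k => exists_min_repr e (h0 k)
  choose q hq hqmax using fun k => exists_max_repr e (h0 k)
  have hqp : ∀ j k, j < k → q j < p k := fun j k hjk => hprec j k hjk _ _ (hq j) (hp k)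
  have hpq : ∀ k, p k ≤ q k := fun k => hpmin k _ (hq k)
  have hqmono : StrictMono q := fun j k hjk => (hqp j k hjk).trans_le (hpq k)
  choose x hxt hx using fun k => htC k (p k) (q k + 1) (v k)
    (hσC hvσ k (Set.mem_univ k)) fun i hi => ⟨hpmin k i hi, Nat.lt_succ_of_le (hqmax k i hi)⟩
  have hxp : ∀ k, (x k).1 = p k := fun k => (ht _ _ _ _ (hxt k)).1
  have hxq : ∀ k, (x k).2.1 = q k + 1 := fun k => (ht _ _ _ _ (hxt k)).2
  have hmem : ∀ {k a}, a ∈ initialSegment x k → ∃ j < k, x j = a := by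
    intro k a ha
    simpa [initialSegment] using ha
  refine hφ x rfl (fun k _ => ⟨⟨fun b hb => ?_, v k, hW' (hvW k), h0 k, ?_⟩, ?_⟩) ?_
  · obtain ⟨j, hjk, rfl⟩ := hmem hb
    rw [hxq, hxp]
    exact hqp j k hjk
  · rw [length_initialSegment]
    exact hx k
  · change _ ≤ (x k).1
    rw [hxp]
    cases k with
    | zero => exact hN _ (hvW 0) _ (hp 0)
    | succ k =>
      refine le_trans (hψ (q k + 1) _ ?_ fun a ha => ?_)
        (hgap _ (hvW k) _ (hvW (k + 1)) (hprec k (k + 1) k.lt_succ_self) _ _ (hq k)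
          (hp (k + 1)))
      · rw [length_initialSegment]
        exact Nat.succ_le_succ (hqmono.id_le k)
      · obtain ⟨j, hjk, rfl⟩ := hmem ha
        have hqj : q j ≤ q k := hqmono.monotone (Nat.le_of_lt_succ hjk)
        have hjq : j ≤ q j := hqmono.id_le j
        have hpj := hpq j
        exact ⟨j, by omega, p j, by omega, q j + 1, by omega, hxt j⟩
  · obtain ⟨z, hz⟩ := hf.superset hvσ
    exact ⟨z, rfl, fun n => hz ▸ hx n⟩

theorem IsBlockList.ne_zero_and_pairwise {l : List E} (hl : IsBlockList e l) :
    (∀ x ∈ l, x ≠ 0) ∧ l.Pairwise (Precedes e) := by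
  obtain ⟨p, -, hp, h⟩ := hl
  refine ⟨fun x hx => ?_, List.pairwise_iff_getElem.2 fun j k hj hk hjk a b ha hb => ?_⟩
  · obtain ⟨k, hk, rfl⟩ := List.getElem_of_mem hx
    exact (h k hk).1
  · have h₁ := (mem_span_image_iff_repr e).1 (h j hj).2 a ha
    have h₂ := (mem_span_image_iff_repr e).1 (h k hk).2 b hb
    exact h₁.2.trans_le ((hp.monotone hjk).trans h₂.1)

theorem BlockSubspace.exists_isBlockList_append (V : BlockSubspace e) {l : List E}
    (hl : IsBlockList e l) : ∃ y ∈ V.1, IsBlockList e (l ++ [y]) := by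
  classical
  obtain ⟨h0, hpair⟩ := hl.ne_zero_and_pairwise
  obtain ⟨N, hN⟩ := exists_forall_mem_repr_lt e l.toFinset
  obtain ⟨y, hy, hy0, hyN⟩ := V.2.exists_mem_tail N
  refine ⟨y, hy, isBlockList_of_pairwise e ?_ (List.pairwise_append.2
    ⟨hpair, List.pairwise_singleton _ _, ?_⟩)⟩
  · intro x hx
    rcases List.mem_append.1 hx with hx | hx
    · exact h0 x hx
    · rwa [List.mem_singleton.1 hx]
  · intro a ha b hb i j hi hj
    rw [List.mem_singleton.1 hb] at hj
    exact (hN a (List.mem_toFinset.2 ha) i hi).trans_le (hyN j hj)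

/-- A transition system in which every good state has, in every block subspace of `V`, a
transition to another good state yields a strategy. -/
theorem exists_blockStrategy_of_transitions {X : Type*} (V : BlockSubspace e)
    (vectors : X → List E) (Good : X → Prop) (Step : X → E → X → Prop) (x₀ : X)
    (hx₀ : Good x₀) (hvec₀ : vectors x₀ = [])
    (hgood : ∀ x y x', Step x y x' → Good x')
    (hvec : ∀ x y x', Step x y x' → vectors x' = vectors x ++ [y])
    (hblock : ∀ x, Good x → IsBlockList e (vectors x))
    (hmove : ∀ x, Good x → ∀ W ≤ V, ∃ y ∈ W.1, ∃ x', Step x y x') :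
    ∃ Φ : BlockStrategy e, ∀ W : ℕ → BlockSubspace e, (∀ j, W j ≤ V) →
      ∃ s : ℕ → X, s 0 = x₀ ∧
        ∀ k, Step (s k) (Φ.outcome (SigmaFin.empty e) W k) (s (k + 1)) := by
  classical
  let advance : X → E → X := fun x y => if h : ∃ x', Step x y x' then h.choose else x
  have hadvance : ∀ {x y}, (∃ x', Step x y x') → Step x y (advance x y) := by
    intro x y h
    simp only [advance, dif_pos h]
    exact h.choose_spec
  -- A strategy sees only the vectors, so the hidden state is recomputed by replaying them.
  let state : List E → X := List.foldl advance x₀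
  have hstate : ∀ l y, state (l ++ [y]) = advance (state l) y := fun l y => by
    simp [state, List.foldl_append]
  have hnext : ∀ (u : SigmaFin e) (W : BlockSubspace e), ∃ y ∈ W.1, IsBlockList e (u.1 ++ [y]) ∧
      (vectors (state u.1) = u.1 → Good (state u.1) → W ≤ V →
        ∃ x', Step (state u.1) y x') := by
    intro u W
    -- Positions off the intended play and subspaces outside `V` still require some legal answer.
    by_cases h : vectors (state u.1) = u.1 ∧ Good (state u.1) ∧ W ≤ V
    · obtain ⟨y, hy, x', hx'⟩ := hmove _ h.2.1 W h.2.2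
      refine ⟨y, hy, ?_, fun _ _ _ => ⟨x', hx'⟩⟩
      have hb := hblock _ (hgood _ _ _ hx')
      rwa [hvec _ _ _ hx', h.1] at hb
    · obtain ⟨y, hy, hb⟩ := W.exists_isBlockList_append u.2
      exact ⟨y, hy, hb, fun h₁ h₂ h₃ => absurd ⟨h₁, h₂, h₃⟩ h⟩
  choose y hyW hyb hystep using hnext
  let Φ : BlockStrategy e :=
    { next := fun u W => ⟨u.1 ++ [y u W], hyb u W⟩
      next_spec := fun u W => ⟨y u W, hyW u W, rfl⟩ }
  refine ⟨Φ, fun W hW => ?_⟩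
  let pos : ℕ → SigmaFin e := Φ.position (SigmaFin.empty e) W
  have hpos : ∀ k, (pos (k + 1)).1 = (pos k).1 ++ [y (pos k) (W k)] := fun _ => rfl
  have hlen : ∀ k, (pos k).1.length = k := by
    intro k
    induction k with
    | zero => rfl
    | succ k ih => rw [hpos, List.length_append, ih, List.length_singleton]
  have hout : ∀ k, Φ.outcome (SigmaFin.empty e) W k = y (pos k) (W k) := by
    intro k
    change (pos (k + 1)).1.getD k 0 = _
    rw [hpos, List.getD_append_right _ _ _ _ (hlen k).le, hlen, Nat.sub_self]
    rfl
  have hinv : ∀ k, vectors (state (pos k).1) = (pos k).1 ∧ Good (state (pos k).1) := by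
    intro k
    induction k with
    | zero => exact ⟨hvec₀, hx₀⟩
    | succ k ih =>
      have hs := hadvance (hystep (pos k) (W k) ih.1 ih.2 (hW k))
      rw [hpos, hstate]
      exact ⟨by rw [hvec _ _ _ hs, ih.1], hgood _ _ _ hs⟩
  refine ⟨fun k => state (pos k).1, rfl, fun k => ?_⟩
  change Step (state (pos k).1) _ (state (pos (k + 1)).1)
  rw [hout, hpos, hstate]
  exact hadvance (hystep (pos k) (W k) (hinv k).1 (hinv k).2 (hW k))

end GameOfCells

/-! ### Infinite plays: convergence of the digits and closedness of the boxes. -/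

section Outcome

universe u

/-- In a sequence of pairs of a list and an ordinal, where at each step either the ordinal drops or
the list grows by one term with `Q` valid, `Q` holds at lists of unbounded length. -/
theorem exists_le_length_of_rank {digits : ℕ → List ℕ} {rank : ℕ → Ordinal.{u}} {Q : ℕ → Prop}
    (h0 : Q 0)
    (h : ∀ k, (digits (k + 1) = digits k ∧ rank (k + 1) < rank k) ∨
      ((∃ m, digits (k + 1) = digits k ++ [m]) ∧ Q (k + 1))) (L : ℕ) :
    ∃ k, L ≤ k ∧ L ≤ (digits k).length ∧ Q k := by
  have hmono : Monotone fun k => (digits k).length := monotone_nat_of_le_succ fun k => by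
    rcases h k with ⟨h, -⟩ | ⟨⟨m, h⟩, -⟩ <;> simp [h]
  induction L with
  | zero => exact ⟨0, le_rfl, Nat.zero_le _, h0⟩
  | succ L ih =>
    obtain ⟨k, hLk, hLd, -⟩ := ih
    -- The rank cannot drop at every step after `k`, so the list grows at some later step.
    obtain ⟨n, hn⟩ := WellFounded.not_rel_apply_succ (r := (· < ·)) fun n => rank (k + n)
    rcases h (k + n) with ⟨-, h⟩ | ⟨⟨m, h⟩, hQ⟩
    · exact absurd h hn
    · refine ⟨k + n + 1, by omega, ?_, hQ⟩
      have : (digits k).length ≤ (digits (k + n)).length := hmono (Nat.le_add_right k n)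
      rw [h, List.length_append, List.length_singleton]
      omega

/-- A chain of lists of unbounded length converges to an infinite sequence. -/
theorem exists_forall_initialSegment {digits : ℕ → List ℕ}
    (hpre : ∀ k, digits k <+: digits (k + 1)) (hlen : ∀ L, ∃ k, L ≤ (digits k).length) :
    ∃ z : ℕ → ℕ, ∀ k, initialSegment z (digits k).length = digits k := by
  have hchain : ∀ j k, j ≤ k → digits j <+: digits k := fun j k hjk => by
    induction k, hjk using Nat.le_induction with
    | base => exact List.prefix_refl _
    | succ k _ ih => exact ih.trans (hpre k)
  choose K hK using fun n => hlen (n + 1)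
  refine ⟨fun n => (digits (K n))[n]'(hK n), fun k => List.ext_getElem (by simp) fun i h₁ h₂ => ?_⟩
  rw [getElem_initialSegment]
  have hmax₁ := hchain (K i) (max (K i) k) (le_max_left _ _)
  have hmax₂ := hchain k (max (K i) k) (le_max_right _ _)
  rw [hmax₁.getElem, hmax₂.getElem]

variable {𝕜 E : Type*} [RCLike 𝕜] [AddCommGroup E] [Module 𝕜 E] {e : Module.Basis ℕ 𝕜 E}

theorem isClosed_setOf_mem_cell {Z : Type*} [TopologicalSpace Z] {g : Z → E}
    (hg : ∀ i, Continuous fun z => e.repr (g z) i) (δ : ℕ → ℝ) (a : BlockLetter) :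
    IsClosed {z | g z ∈ cell e δ a} := by
  have h : {z | g z ∈ cell e δ a} =
      (⋂ i, ⋂ (_ : a.1 ≤ i), ⋂ (_ : i < a.2.1),
        {z | ‖e.repr (g z) i - TopologicalSpace.denseSeq 𝕜 (a.2.2 i)‖ ≤ δ i}) ∩
      ⋂ i, ⋂ (_ : ¬ (a.1 ≤ i ∧ i < a.2.1)), {z | e.repr (g z) i = 0} := by
    ext z
    simp only [cell, Set.mem_inter_iff, Set.mem_iInter, Set.mem_ofPred_eq]
  rw [h]
  exact (isClosed_iInter fun i => isClosed_iInter fun _ => isClosed_iInter fun _ =>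
    isClosed_le ((hg i).sub continuous_const).norm continuous_const).inter
    (isClosed_iInter fun i => isClosed_iInter fun _ => isClosed_eq (hg i) continuous_const)

/-- The scheme of cells is closed: it is determined by finite approximations. -/
theorem mem_cell_of_forall_cellScheme {δ : ℕ → ℕ → ℝ} {f : (ℕ → ℕ) → ℕ → E}
    (hf : ∀ n i, Continuous fun z => e.repr (f z n) i) {a : ℕ → BlockLetter} {z : ℕ → ℕ}
    (h : ∀ L, ∃ k d, L ≤ k ∧ L ≤ d ∧ ∃ x ∈ cellScheme e δ f (initialSegment z d),
      initialSegment x k = initialSegment a k) (n : ℕ) :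
    f z n ∈ cell e (δ n) (a n) := by
  choose k d hk hd x hx hxa using h
  choose w hw hwx using hx
  have hget : ∀ {α : Type} {u v : ℕ → α} {m i : ℕ}, initialSegment u m = initialSegment v m →
      i < m → u i = v i := by
    intro α u v m i huv him
    have := congrArg (fun l => l[i]?) huv
    simpa [initialSegment, him] using this
  -- `w L` agrees with `z` on at least its first `L` digits.
  have hlim : Filter.Tendsto w Filter.atTop (nhds z) := by
    refine tendsto_pi_nhds.2 fun i => tendsto_const_nhds.congr' ?_
    filter_upwards [Filter.eventually_gt_atTop i] with L hL
    have hwL := hw L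
    rw [length_initialSegment] at hwL
    exact (hget hwL (hL.trans_le (hd L))).symm
  refine (isClosed_setOf_mem_cell (hf n) (δ n) (a n)).mem_of_tendsto hlim ?_
  filter_upwards [Filter.eventually_gt_atTop n] with L hL
  rw [← hget (hxa L) (hL.trans_le (hk L))]
  exact hwx L n

/-- The positions of the strategy of the second player in the Gowers game, together with the
letters and digits played in the auxiliary game and the rank of the position. -/
structure PlayState (E : Type u) where
  vectors : List E
  letters : List BlockLetter
  digits : List ℕ
  rank : Ordinal.{u}

/-- If the second player can go on forever from good pair to good pair in the game of cells, then
he has a strategy in the Gowers game whose outcome is termwise in the cells of a sequence `f z`. -/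
theorem exists_blockStrategy_of_reaches {𝕜 : Type*} {E : Type u} [RCLike 𝕜] [AddCommGroup E]
    [Module 𝕜 E] {e : Module.Basis ℕ 𝕜 E} {δ : ℕ → ℕ → ℝ} {f : (ℕ → ℕ) → ℕ → E}
    (hf : ∀ n i, Continuous fun z => e.repr (f z n) i) (V : BlockSubspace e)
    (P : List BlockLetter → List ℕ → Prop) (hP : P [] [])
    (hnext : ∀ l s, P l s → (∃ x ∈ cellScheme e δ f s, initialSegment x l.length = l) ∧
      ∃ α, (cellGame e δ).Reaches V (fun l' => ∃ m, P l' (s ++ [m])) α l) :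
    ∃ Φ : BlockStrategy e, ∀ W : ℕ → BlockSubspace e, (∀ j, W j ≤ V) →
      Φ.outcome (SigmaFin.empty e) W ∈ SigmaInf e ∧ ∃ (z : ℕ → ℕ) (a : ℕ → BlockLetter),
        ∀ n, Φ.outcome (SigmaFin.empty e) W n ∈ cell e (δ n) (a n) ∧ f z n ∈ cell e (δ n) (a n) := by
  let T : List ℕ → List BlockLetter → Prop := fun s l => ∃ m, P l (s ++ [m])
  let Good : PlayState E → Prop := fun x =>
    (∀ y ∈ x.vectors, y ≠ 0) ∧ x.vectors.Pairwise (Precedes e) ∧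
    -- Right ends of letters bound the supports, so the rule that a new letter starts after all
    -- earlier ones makes the next vector successive.
    (∀ y ∈ x.vectors, ∀ i, e.repr y i ≠ 0 → ∃ b ∈ x.letters, i < b.2.1) ∧
    (cellGame e δ).Reaches V (T x.digits) x.rank x.letters
  let Step : PlayState E → E → PlayState E → Prop := fun x y x' => Good x' ∧
    ∃ a, y ∈ cell e (δ x.letters.length) a ∧ x'.vectors = x.vectors ++ [y] ∧
      x'.letters = x.letters ++ [a] ∧ ((x'.digits = x.digits ∧ x'.rank < x.rank) ∨
        ((∃ m, x'.digits = x.digits ++ [m]) ∧ P x'.letters x'.digits))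
  obtain ⟨-, α₀, hα₀⟩ := hnext [] [] hP
  have hmove : ∀ x, Good x → ∀ W ≤ V, ∃ y ∈ W.1, ∃ x', Step x y x' := by
    rintro x ⟨h0, hpair, hsupp, hR⟩ W hW
    rw [BlockGame.Reaches] at hR
    obtain ⟨a, ⟨hba, y, hyW, hy0, hya⟩, hR⟩ := hR W hW
    have h0' : ∀ y' ∈ x.vectors ++ [y], y' ≠ 0 := by
      intro y' hy'
      rcases List.mem_append.1 hy' with hy' | hy'
      · exact h0 y' hy'
      · rwa [List.mem_singleton.1 hy']
    have hpair' : (x.vectors ++ [y]).Pairwise (Precedes e) := by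
      refine List.pairwise_append.2 ⟨hpair, List.pairwise_singleton _ _, ?_⟩
      intro y₁ hy₁ y₂ hy₂ i j hi hj
      rw [List.mem_singleton.1 hy₂] at hj
      obtain ⟨b, hb, hib⟩ := hsupp y₁ hy₁ i hi
      exact (hib.trans_le (hba b hb)).trans_le (mem_Ico_of_mem_cell hya hj).1
    have hsupp' : ∀ y' ∈ x.vectors ++ [y], ∀ i, e.repr y' i ≠ 0 →
        ∃ b ∈ x.letters ++ [a], i < b.2.1 := by
      intro y' hy' i hi
      rcases List.mem_append.1 hy' with hy' | hy'
      · obtain ⟨b, hb, hib⟩ := hsupp y' hy' i hi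
        exact ⟨b, List.mem_append_left _ hb, hib⟩
      · rw [List.mem_singleton.1 hy'] at hi
        exact ⟨a, by simp, (mem_Ico_of_mem_cell hya hi).2⟩
    refine ⟨y, hyW, ?_⟩
    rcases hR with ⟨m, hm⟩ | ⟨β, hβ, hR⟩
    -- A new digit has been won: a fresh rank is drawn for the longer string.
    · obtain ⟨-, α, hα⟩ := hnext _ _ hm
      exact ⟨⟨x.vectors ++ [y], x.letters ++ [a], x.digits ++ [m], α⟩,
        ⟨h0', hpair', hsupp', hα⟩, a, hya, rfl, rfl, Or.inr ⟨⟨m, rfl⟩, hm⟩⟩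
    · exact ⟨⟨x.vectors ++ [y], x.letters ++ [a], x.digits, β⟩,
        ⟨h0', hpair', hsupp', hR⟩, a, hya, rfl, rfl, Or.inl ⟨rfl, hβ⟩⟩
  obtain ⟨Φ, hΦ⟩ := exists_blockStrategy_of_transitions V PlayState.vectors Good Step
    ⟨[], [], [], α₀⟩ ⟨by simp, List.Pairwise.nil, by simp, hα₀⟩ rfl (fun _ _ _ h => h.1)
    (fun _ _ _ ⟨_, _, _, h, _⟩ => h) (fun _ h => isBlockList_of_pairwise e h.1 h.2.1) hmove
  refine ⟨Φ, fun W hW => ?_⟩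
  obtain ⟨s, hs0, hs⟩ := hΦ W hW
  set y := Φ.outcome (SigmaFin.empty e) W with hy
  choose hsgood a hya hsvec hslet hsdig using hs
  have hvec : ∀ k, (s k).vectors = initialSegment y k := by
    intro k
    induction k with
    | zero => rw [hs0]; rfl
    | succ k ih => rw [hsvec, ih, initialSegment_succ]
  have hlet : ∀ k, (s k).letters = initialSegment a k := by
    intro k
    induction k with
    | zero => rw [hs0]; rfl
    | succ k ih => rw [hslet, ih, initialSegment_succ]
  have hmem : ∀ j k, j < k → y j ∈ initialSegment y k := fun j k hjk =>
    List.mem_map.2 ⟨j, List.mem_range.2 hjk, rfl⟩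
  refine ⟨(isBlockSeq_iff e).2 ⟨fun k => (hsgood k).1 _ (hvec (k + 1) ▸ hmem k _ k.lt_succ_self),
    fun k l hkl => ?_⟩, ?_⟩
  · have hp := (hsgood l).2.1
    rw [hvec, initialSegment_succ] at hp
    exact (List.pairwise_append.1 hp).2.2 _ (hmem k l hkl) _ (List.mem_singleton_self _)
  · have hlong := exists_le_length_of_rank (digits := fun k => (s k).digits)
      (rank := fun k => (s k).rank) (Q := fun k => P (s k).letters (s k).digits)
      (by rw [hs0]; exact hP) hsdig
    obtain ⟨z, hz⟩ := exists_forall_initialSegment (digits := fun k => (s k).digits)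
      (fun k => by
        rcases hsdig k with ⟨h, -⟩ | ⟨⟨m, h⟩, -⟩
        · rw [h]
        · rw [h]
          exact List.prefix_append _ _)
      (fun L => (hlong L).imp fun _ h => h.2.1)
    refine ⟨z, a, fun n => ⟨?_, mem_cell_of_forall_cellScheme hf (fun L => ?_) n⟩⟩
    · have := hya n
      rwa [hlet, length_initialSegment] at this
    · obtain ⟨k, hLk, hLd, hk⟩ := hlong L
      obtain ⟨⟨x, hx, hxk⟩, -⟩ := hnext _ _ hk
      refine ⟨k, _, hLk, hLd, x, (hz k).symm ▸ hx, ?_⟩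
      rwa [hlet, length_initialSegment] at hxk

end Outcome

theorem mainTheorem2 {𝕜 E : Type*} [RCLike 𝕜] [AddCommGroup E] [Module 𝕜 E]
    (e : Module.Basis ℕ 𝕜 E)
    (σ : Set (ℕ → E)) (hσ : σ ⊆ SigmaInf e) (hlarge : IsLarge e σ)
    (C : ℕ → Set E) (hCconv : ∀ n, AbsConvex 𝕜 (C n))
    (hCcomp : ∀ n, IsFinDimCompact 𝕜 (C n))
    (hσC : σ ⊆ Set.univ.pi C)
    (hanalytic : IsAnalyticInSigmaInf e σ)
    (ρ : ℕ → E → ℝ) (hρ : ∀ n, IsFNorm 𝕜 (ρ n)) :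
    ∀ ε : ℝ, 0 < ε →
      ∃ V : BlockSubspace e, IsStrategicallyLarge e (enlargement e ρ σ ε) V := by
  intro ε hε
  obtain ⟨δ, hδ, hδρ⟩ := exists_box_blockDist_lt hρ e hε
  have hV₀ : IsBlockSubspace e (Submodule.span 𝕜 (Set.range e)) :=
    isBlockSubspace_span e.ne_zero fun k l hkl i j hi hj => by
      simp only [Module.Basis.repr_self, Finsupp.single_apply, ne_eq, ite_eq_right_iff,
        not_forall] at hi hj
      obtain ⟨rfl, -⟩ := hi
      obtain ⟨rfl, -⟩ := hj
      exact hkl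
  -- Largeness in the whole space makes `σ` nonempty, as the parametrization requires.
  obtain ⟨u, huσ, -⟩ := hlarge _ hV₀
  obtain ⟨f, hfσ, hf⟩ := hanalytic.exists_parametrization hσ ⟨u, huσ⟩
  obtain ⟨V, -, hV⟩ := (cellGame e δ).exists_avoids_or_reaches (cellScheme e δ f)
    (cellScheme_subset_iUnion e δ f) ⟨_, hV₀⟩
  obtain ⟨P, hP, hnext⟩ := hV.resolve_left
    (not_avoids_cellScheme hlarge hCcomp hσC hδ hfσ V)
  obtain ⟨Φ, hΦ⟩ := exists_blockStrategy_of_reaches hf V P hP hnext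
  refine ⟨V, Φ, fun W hW => ?_⟩
  obtain ⟨hblock, z, a, hza⟩ := hΦ W hW
  refine ⟨hblock, (iInf₂_le (f z) (hfσ.subset ⟨z, rfl⟩)).trans_lt (hδρ _ _ fun n i => ?_)⟩
  exact norm_repr_sub_le_of_mem_cell (hδ n) (hza n).1 (hza n).2 i
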